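/- A \emph{bivariate copula} is a function $C\colon[0,1]^2\to[0,1]$ with $C(u,0)=0=C(0,v)$, $C(u,1)=u$, $C(1,v)=v$ and $C(u,v)-C(u,y)-C(x,v)+C(x,y)\ge 0$ whenever $x\le u$ and $y\le v$. It induces a unique Borel measure $\mu_C$ on $[0,1]^2$ with $\mu_C([x,u]\times[y,v])=C(u,v)-C(u,y)-C(x,v)+C(x,y)$ for $x\le u$, $y\le v$. For copulas $C,D$ put $$C*D(x,y)=\int_0^1\partial_2C(x,t)\,\partial_1D(t,y)\,dt,\qquad \|C\|=\Bigl(\int_0^1\!\!\int_0^1\bigl((\partial_1C)^2+(\partial_2C)^2\bigr)\,dx\,dy\Bigr)^{1/2},$$ and let $M(x,y)=\min(x,y)$. For $T\colon[0,1]\to[0,1]$ let $S_T(u,v)=(T(u),v)$. A copula $C$ is a \emph{generalized shuffle} of a copula $D$ if $\mu_C$ is the push-forward of $\mu_D$ under $S_T$ for some (Borel measurable) bijection $T$ of $[0,1]$ that preserves Lebesgue measure; it is a \emph{shuffle} of $D$ if $T$ can moreover be chosen piecewise continuous (i.e. with only finitely many discontinuities). A (generalized) shuffle of Min is a (generalized)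 shuffle of $M$. \textbf{Theorem.} Let $C$ and $D$ be bivariate copulas. Then \begin{enumerate} \item $C$ is a shuffle of $D$ if and only if there exists a shuffle of Min $A$ such that $C=A*D$; \item $C$ is a generalized shuffle of $D$ if and only if there exists a generalized shuffle of Min $A$ such that $C=A*D$; equivalently, if and only if there exists a copula $A$ with $\|A\|=1$ such that $C=A*D$. \end{enumerate} -/

import Mathlib

open MeasureTheory Set unitInterval

/-- A bivariate copula: a grounded, `2`-increasing function `[0,1]² → [0,1]` with uniform margins. -/
@[ext]
structure Copula where
  /-- The underlying function on the unit square. -/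
  toFun : I → I → ℝ
  mem_Icc : ∀ u v, toFun u v ∈ Icc (0 : ℝ) 1
  right_zero : ∀ u, toFun u 0 = 0
  left_zero : ∀ v, toFun 0 v = 0
  right_one : ∀ u, toFun u 1 = u
  left_one : ∀ v, toFun 1 v = v
  two_increasing : ∀ x u y v, x ≤ u → y ≤ v →
    0 ≤ toFun u v - toFun u y - toFun x v + toFun x y

namespace Copula

instance : CoeFun Copula (fun _ => I → I → ℝ) := ⟨Copula.toFun⟩

/-- The comonotonicity copula `M(x, y) = min(x, y)`. -/
def M : Copula where
  toFun x y := min (x : ℝ) (y : ℝ)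
  mem_Icc u v := ⟨le_min u.2.1 v.2.1, (min_le_left _ _).trans u.2.2⟩
  right_zero u := by simpa using u.2.1
  left_zero v := by simpa using v.2.1
  right_one u := by simpa using u.2.2
  left_one v := by simpa using v.2.2
  two_increasing x u y v hx hy := by
    have h1 : (x : ℝ) ≤ u := hx
    have h2 : (y : ℝ) ≤ v := hy
    grind

/-- The partial derivative `∂₁C(x, y)`.  The section `C(·, y)` is extended constantly outside
`[0,1]`; for `x` in the open interval this is the ordinary derivative (when it exists, otherwise
`0`). -/
noncomputable def partial1 (C : Copula) (x y : I) : ℝ :=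
  deriv (fun s : ℝ => C (projIcc 0 1 zero_le_one s) y) x

/-- The partial derivative `∂₂C(x, y)`, with the same conventions as `∂₁C`. -/
noncomputable def partial2 (C : Copula) (x y : I) : ℝ :=
  deriv (fun t : ℝ => C x (projIcc 0 1 zero_le_one t)) y

/-- The product `(C * D)(x, y) = ∫₀¹ ∂₂C(x, t) ∂₁D(t, y) dt`. -/
noncomputable def star (C D : Copula) (x y : I) : ℝ :=
  ∫ t : I, C.partial2 x t * D.partial1 t y

/-- The (modified) Sobolev norm `‖C‖ = (∫₀¹∫₀¹ (∂₁C)² + (∂₂C)² dx dy)^(1/2)`. -/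
noncomputable def sobolevNorm (C : Copula) : ℝ :=
  Real.sqrt (∫ y : I, ∫ x : I, (C.partial1 x y ^ 2 + C.partial2 x y ^ 2))

/-! ### The measure induced by a copula -/

theorem mono_left (C : Copula) (y : I) : Monotone (fun x => C x y) := by
  intro x u h
  have := C.two_increasing x u 0 y h y.2.1
  simp only [C.right_zero] at this
  show C x y ≤ C u y
  linarith

theorem mono_right (C : Copula) (x : I) : Monotone (fun y => C x y) := by
  intro y v h
  have := C.two_increasing 0 x y v x.2.1 h
  simp only [C.left_zero] at this
  show C x y ≤ C x v
  linarith

theorem sub_le_left (C : Copula) {x u : I} (h : x ≤ u) (y : I) :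
    C u y - C x y ≤ u - x := by
  have := C.two_increasing x u y 1 h y.2.2
  simp only [C.right_one] at this
  linarith

theorem sub_le_right (C : Copula) (x : I) {y v : I} (h : y ≤ v) :
    C x v - C x y ≤ v - y := by
  have := C.two_increasing x 1 y v x.2.2 h
  simp only [C.left_one] at this
  linarith

theorem lipschitz_ext (C : Copula) (y : I) :
    LipschitzWith 1 (fun s : ℝ => C (projIcc 0 1 zero_le_one s) y) := by
  have h1 : LipschitzWith 1 (fun x : I => C x y) := by
    refine LipschitzWith.of_dist_le_mul fun x u => ?_
    rw [NNReal.coe_one, one_mul, Subtype.dist_eq, Real.dist_eq, Real.dist_eq]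
    rcases le_total x u with h | h
    · have h2 : (x : ℝ) ≤ u := h
      have := C.mono_left y h
      have := C.sub_le_left h y
      rw [abs_sub_comm, abs_sub_comm (x : ℝ), abs_of_nonneg, abs_of_nonneg] <;> grind
    · have h2 : (u : ℝ) ≤ x := h
      have := C.mono_left y h
      have := C.sub_le_left h y
      rw [abs_of_nonneg, abs_of_nonneg] <;> grind
  have h2 := h1.comp (LipschitzWith.projIcc (zero_le_one (α := ℝ)))
  rwa [one_mul] at h2

theorem mono_ext (C : Copula) (y : I) :
    Monotone (fun s : ℝ => C (projIcc 0 1 zero_le_one s) y) :=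
  (C.mono_left y).comp (monotone_projIcc _)

theorem partial1_nonneg (C : Copula) (x y : I) : 0 ≤ C.partial1 x y :=
  (C.mono_ext y).deriv_nonneg

theorem partial1_le_one (C : Copula) (x y : I) : C.partial1 x y ≤ 1 := by
  have := norm_deriv_le_of_lipschitz (x₀ := (x : ℝ)) (C.lipschitz_ext y)
  rw [NNReal.coe_one] at this
  exact (le_abs_self _).trans this

theorem measurable_partial1 (C : Copula) (y : I) : Measurable (fun x => C.partial1 x y) :=
  (measurable_deriv _).comp measurable_subtype_coe

theorem ae_partial1_mono (C : Copula) {y v : I} (h : y ≤ v) :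
    ∀ᵐ x : I, C.partial1 x y ≤ C.partial1 x v := by
  have key : ∀ᵐ s : ℝ, deriv (fun s : ℝ => C (projIcc 0 1 zero_le_one s) y) s ≤
      deriv (fun s : ℝ => C (projIcc 0 1 zero_le_one s) v) s := by
    filter_upwards [(C.mono_ext y).ae_differentiableAt, (C.mono_ext v).ae_differentiableAt]
      with s h1 h2
    have h3 : Monotone (fun s : ℝ => C (projIcc 0 1 zero_le_one s) v -
        C (projIcc 0 1 zero_le_one s) y) := by
      intro a b hab
      have := C.two_increasing _ _ y v (monotone_projIcc (zero_le_one (α := ℝ)) hab) h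
      show _ - _ ≤ _ - _
      linarith
    have h4 := h3.deriv_nonneg (x := s)
    rw [deriv_fun_sub h2 h1] at h4
    linarith
  exact measurePreserving_coe.quasiMeasurePreserving.ae (ae_restrict_of_ae key)

theorem setIntegral_partial1 (C : Copula) (x y : I) :
    ∫ s in Iic x, C.partial1 s y = C x y := by
  have h1 : ∫ s in Iic x, C.partial1 s y =
      ∫ s in (0 : ℝ)..x, deriv (fun s : ℝ => C (projIcc 0 1 zero_le_one s) y) s := by
    have hset : (Iic x : Set I) = ((↑) : I → ℝ) ⁻¹' Icc 0 (x : ℝ) := by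
      ext s
      simp only [mem_Iic, mem_preimage]
      exact ⟨fun h => ⟨s.2.1, h⟩, fun h => h.2⟩
    rw [intervalIntegral.integral_of_le x.2.1, ← integral_Icc_eq_integral_Ioc, hset]
    have := measurePreserving_coe.setIntegral_preimage_emb measurableEmbedding_coe
      (deriv (fun s : ℝ => C (projIcc 0 1 zero_le_one s) y)) (Icc 0 (x : ℝ))
    rw [Measure.restrict_restrict measurableSet_Icc,
      inter_eq_left.2 (Icc_subset_Icc_right x.2.2)] at this
    exact this
  rw [h1, AbsolutelyContinuousOnInterval.integral_deriv_eq_sub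
    ((C.lipschitz_ext y).lipschitzOnWith.absolutelyContinuousOnInterval)]
  simp [C.left_zero]

theorem setLIntegral_partial1 (C : Copula) (x y : I) :
    ∫⁻ s in Iic x, ENNReal.ofReal (C.partial1 s y) = ENNReal.ofReal (C x y) := by
  rw [← setIntegral_partial1, ofReal_integral_eq_lintegral_ofReal]
  · refine Measure.integrableOn_of_bounded (M := 1) (by finiteness)
      (C.measurable_partial1 y).aestronglyMeasurable (ae_of_all _ fun s => ?_)
    rw [Real.norm_of_nonneg (C.partial1_nonneg s y)]
    exact C.partial1_le_one s y
  · exact ae_of_all _ fun s => C.partial1_nonneg s y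

/-- Conditional quantile function: the second coordinate given the first coordinate is `p.1`, as a
function of a uniform random number `p.2`. -/
noncomputable def quantile (C : Copula) (p : I × I) : I :=
  ⨅ q : ℚ, if (p.2 : ℝ) ≤ C.partial1 p.1 (projIcc 0 1 zero_le_one (q : ℝ))
    then projIcc 0 1 zero_le_one (q : ℝ) else 1

theorem measurable_quantile (C : Copula) : Measurable C.quantile := by
  refine Measurable.iInf fun q => Measurable.ite ?_ measurable_const measurable_const
  exact measurableSet_le (measurable_subtype_coe.comp measurable_snd)
    ((C.measurable_partial1 _).comp measurable_fst)

/-- Auxiliary measure: the law of `(s, quantile (s, t))` with `s`, `t` independent and uniform. -/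
noncomputable def lawMeasure (C : Copula) : Measure (I × I) :=
  (volume : Measure (I × I)).map (fun p => (p.1, C.quantile p))

theorem lawMeasure_eq (C : Copula) (x y : I) :
    C.lawMeasure (Iic x ×ˢ Iic y) =
      ∫⁻ s in Iic x, volume {t : I | C.quantile (s, t) ≤ y} := by
  have hm : Measurable (fun p : I × I => (p.1, C.quantile p)) :=
    measurable_fst.prodMk C.measurable_quantile
  have hs : MeasurableSet (Iic x ×ˢ Iic y : Set (I × I)) := measurableSet_Iic.prod measurableSet_Iic
  rw [lawMeasure, Measure.map_apply hm hs, Measure.volume_eq_prod,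
    Measure.prod_apply (hm hs), ← lintegral_indicator measurableSet_Iic]
  refine lintegral_congr fun s => ?_
  by_cases h : s ≤ x
  · rw [indicator_of_mem (by exact h)]
    congr 1
    ext t
    simp [h]
  · rw [indicator_of_notMem (by exact h)]
    convert measure_empty (μ := (volume : Measure I))
    ext t
    simp [h]

theorem volume_le_eq (a : ℝ) (h0 : 0 ≤ a) (h1 : a ≤ 1) :
    volume {t : I | (t : ℝ) ≤ a} = ENNReal.ofReal a := by
  have : {t : I | (t : ℝ) ≤ a} = Iic (⟨a, h0, h1⟩ : I) := rfl
  rw [this, unitInterval.volume_Iic]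

theorem le_lawMeasure (C : Copula) (x y : I) (q : ℚ) (hq : (q : ℝ) ≤ y) :
    ENNReal.ofReal (C x (projIcc 0 1 zero_le_one (q : ℝ))) ≤ C.lawMeasure (Iic x ×ˢ Iic y) := by
  rw [lawMeasure_eq, ← setLIntegral_partial1]
  refine lintegral_mono fun s => ?_
  rw [← volume_le_eq _ (C.partial1_nonneg _ _) (C.partial1_le_one _ _)]
  refine measure_mono fun t ht => ?_
  have ht' : (t : ℝ) ≤ C.partial1 s (projIcc 0 1 zero_le_one (q : ℝ)) := ht
  have h1 : C.quantile (s, t) ≤ _ := iInf_le _ q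
  rw [if_pos ht'] at h1
  refine h1.trans ?_
  rw [← projIcc_val (zero_le_one (α := ℝ)) y]
  exact monotone_projIcc _ hq

theorem lawMeasure_le (C : Copula) (x y : I) (r : ℚ) (hr : (y : ℝ) < r) (hr1 : (r : ℝ) ≤ 1) :
    C.lawMeasure (Iic x ×ˢ Iic y) ≤ ENNReal.ofReal (C x (projIcc 0 1 zero_le_one (r : ℝ))) := by
  rw [lawMeasure_eq, ← setLIntegral_partial1]
  have hmono : ∀ᵐ s : I, ∀ q : ℚ, q ≤ r →
      C.partial1 s (projIcc 0 1 zero_le_one (q : ℝ)) ≤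
        C.partial1 s (projIcc 0 1 zero_le_one (r : ℝ)) := by
    refine ae_all_iff.2 fun q => ?_
    by_cases h : q ≤ r
    · have h' : (q : ℝ) ≤ r := by exact_mod_cast h
      filter_upwards [C.ae_partial1_mono (monotone_projIcc (zero_le_one (α := ℝ)) h')]
        with s hs _ using hs
    · exact ae_of_all _ fun s hs => absurd hs h
  refine lintegral_mono_ae (ae_restrict_of_ae ?_)
  filter_upwards [hmono] with s hs
  rw [← volume_le_eq _ (C.partial1_nonneg _ _) (C.partial1_le_one _ _)]
  refine measure_mono fun t (ht : C.quantile (s, t) ≤ y) => ?_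
  have hr0 : (0 : ℝ) ≤ r := y.2.1.trans hr.le
  have hlt : C.quantile (s, t) < (⟨r, hr0, hr1⟩ : I) := lt_of_le_of_lt ht hr
  obtain ⟨q, hq⟩ := iInf_lt_iff.1 hlt
  split_ifs at hq with hc
  · refine le_trans hc (hs q ?_)
    by_contra hcon
    push Not at hcon
    have h' : (r : ℝ) ≤ q := by exact_mod_cast hcon.le
    have := monotone_projIcc (zero_le_one (α := ℝ)) h'
    rw [projIcc_of_mem (zero_le_one (α := ℝ)) (⟨hr0, hr1⟩ : (r : ℝ) ∈ Icc (0 : ℝ) 1)] at this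
    exact absurd hq (not_lt.2 this)
  · exact absurd hr1 (not_le.2 hq)

theorem lawMeasure_fst (C : Copula) (x : I) :
    C.lawMeasure (Iic x ×ˢ univ) = ENNReal.ofReal x := by
  have hm : Measurable (fun p : I × I => (p.1, C.quantile p)) :=
    measurable_fst.prodMk C.measurable_quantile
  rw [lawMeasure, Measure.map_apply hm (measurableSet_Iic.prod MeasurableSet.univ)]
  have : (fun p : I × I => (p.1, C.quantile p)) ⁻¹' (Iic x ×ˢ univ) = Iic x ×ˢ univ := by
    ext p; simp
  rw [this, Measure.volume_eq_prod, Measure.prod_prod, unitInterval.volume_Iic, measure_univ,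
    mul_one]

theorem lawMeasure_Iic (C : Copula) (x y : I) :
    C.lawMeasure (Iic x ×ˢ Iic y) = ENNReal.ofReal (C x y) := by
  have hle : ∀ ε : ℝ, 0 < ε →
      C.lawMeasure (Iic x ×ˢ Iic y) ≤ ENNReal.ofReal (C x y + ε) := by
    intro ε hε
    rcases eq_or_lt_of_le y.2.2 with h1 | h1
    · have hy : y = 1 := Subtype.ext h1
      subst hy
      refine (measure_mono (prod_mono_right (subset_univ _))).trans ?_
      rw [C.lawMeasure_fst, C.right_one]
      exact ENNReal.ofReal_le_ofReal (by linarith)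
    · obtain ⟨r, hr, hr'⟩ := exists_rat_btwn (show (y : ℝ) < min 1 (y + ε) by
        rw [lt_min_iff]; exact ⟨h1, by linarith⟩)
      have hr1 : (r : ℝ) ≤ 1 := (hr'.trans_le (min_le_left _ _)).le
      have hr2 : (r : ℝ) < y + ε := hr'.trans_le (min_le_right _ _)
      refine (C.lawMeasure_le x y r hr hr1).trans (ENNReal.ofReal_le_ofReal ?_)
      have hmem : (r : ℝ) ∈ Icc (0 : ℝ) 1 := ⟨y.2.1.trans hr.le, hr1⟩
      rw [projIcc_of_mem _ hmem]
      have := C.sub_le_right x (y := y) (v := ⟨r, hmem⟩) hr.le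
      simp only at this
      linarith
  have hge : ∀ ε : ℝ, 0 < ε →
      ENNReal.ofReal (C x y - ε) ≤ C.lawMeasure (Iic x ×ˢ Iic y) := by
    intro ε hε
    obtain ⟨q, hq, hq'⟩ := exists_rat_btwn (show (y : ℝ) - ε < y by linarith)
    refine (ENNReal.ofReal_le_ofReal ?_).trans (C.le_lawMeasure x y q hq'.le)
    have hmem : projIcc 0 1 zero_le_one (q : ℝ) ≤ y := by
      rw [← projIcc_val (zero_le_one (α := ℝ)) y]
      exact monotone_projIcc _ hq'.le
    have := C.sub_le_right x hmem
    have h3 : (q : ℝ) ≤ projIcc 0 1 (zero_le_one (α := ℝ)) (q : ℝ) := by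
      rw [coe_projIcc, min_eq_right (hq'.le.trans y.2.2)]
      exact le_max_right _ _
    linarith
  have hfin : C.lawMeasure (Iic x ×ˢ Iic y) ≠ ⊤ :=
    ne_top_of_le_ne_top ENNReal.ofReal_ne_top (hle 1 one_pos)
  rw [← ENNReal.ofReal_toReal hfin]
  congr 1
  refine le_antisymm (le_of_forall_pos_le_add fun ε hε => ?_)
    (le_of_forall_pos_le_add fun ε hε => ?_)
  · have h0 : 0 ≤ C x y + ε := add_nonneg (C.mem_Icc x y).1 hε.le
    exact ENNReal.toReal_le_of_le_ofReal h0 (hle ε hε)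
  · have := (ENNReal.ofReal_le_iff_le_toReal hfin).1 (hge ε hε)
    linarith

/-- A finite measure on the unit square is determined by its values on the sets
`[0,x] × [0,y]`. -/
theorem measure_ext_Iic {μ ν : Measure (I × I)} [IsFiniteMeasure μ]
    (h : ∀ x y : I, μ (Iic x ×ˢ Iic y) = ν (Iic x ×ˢ Iic y)) : μ = ν := by
  have hgen : (inferInstance : MeasurableSpace (I × I)) =
      MeasurableSpace.generateFrom (image2 (· ×ˢ ·) (range (Iic : I → Set I)) (range Iic)) := by
    refine (generateFrom_eq_prod ?_ ?_ ?_ ?_).symm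
    · rw [← borel_eq_generateFrom_Iic, ← BorelSpace.measurable_eq]
    · rw [← borel_eq_generateFrom_Iic, ← BorelSpace.measurable_eq]
    · exact ⟨fun _ => Iic 1, fun _ => ⟨1, rfl⟩, by
        rw [iUnion_const]; exact eq_univ_of_forall fun x => x.2.2⟩
    · exact ⟨fun _ => Iic 1, fun _ => ⟨1, rfl⟩, by
        rw [iUnion_const]; exact eq_univ_of_forall fun x => x.2.2⟩
  refine ext_of_generate_finite _ hgen (isPiSystem_Iic.prod isPiSystem_Iic) ?_ ?_
  · rintro _ ⟨_, ⟨x, rfl⟩, _, ⟨y, rfl⟩, rfl⟩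
    exact h x y
  · have : (univ : Set (I × I)) = Iic 1 ×ˢ Iic 1 := by
      symm; exact eq_univ_of_forall fun p => ⟨p.1.2.2, p.2.2.2⟩
    rw [this, h]

theorem measure_rect_of_Iic (C : Copula) {μ : Measure (I × I)} [IsFiniteMeasure μ]
    (h : ∀ x y : I, μ (Iic x ×ˢ Iic y) = ENNReal.ofReal (C x y)) {x u y v : I}
    (hx : x ≤ u) (hy : y ≤ v) :
    μ (Icc x u ×ˢ Icc y v) = ENNReal.ofReal (C u v - C u y - C x v + C x y) := by
  have hIic : (Iic 1 : Set I) = univ := eq_univ_of_forall fun x => x.2.2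
  have hfst : μ.map Prod.fst = volume := by
    refine Measure.ext_of_Iic _ _ fun a => ?_
    rw [Measure.map_apply measurable_fst measurableSet_Iic, ← prod_univ, ← hIic, h, C.right_one,
      unitInterval.volume_Iic]
  have hsnd : μ.map Prod.snd = volume := by
    refine Measure.ext_of_Iic _ _ fun a => ?_
    rw [Measure.map_apply measurable_snd measurableSet_Iic, ← univ_prod, ← hIic, h, C.left_one,
      unitInterval.volume_Iic]
  have h0 : μ (Prod.fst ⁻¹' {x}) = 0 := by
    rw [← Measure.map_apply measurable_fst (measurableSet_singleton x), hfst, measure_singleton]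
  have h1 : μ (Prod.snd ⁻¹' {y}) = 0 := by
    rw [← Measure.map_apply measurable_snd (measurableSet_singleton y), hsnd, measure_singleton]
  have hae : μ (Icc x u ×ˢ Icc y v) = μ (Ioc x u ×ˢ Ioc y v) := by
    refine le_antisymm ?_ (measure_mono (prod_mono Ioc_subset_Icc_self Ioc_subset_Icc_self))
    have hsub : (Icc x u ×ˢ Icc y v : Set (I × I)) ⊆
        (Ioc x u ×ˢ Ioc y v) ∪ (Prod.fst ⁻¹' {x} ∪ Prod.snd ⁻¹' {y}) := by
      rintro ⟨a, b⟩ ⟨⟨ha, ha'⟩, hb, hb'⟩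
      by_cases h2 : a = x
      · exact Or.inr (Or.inl h2)
      by_cases h3 : b = y
      · exact Or.inr (Or.inr h3)
      exact Or.inl ⟨⟨lt_of_le_of_ne ha (Ne.symm h2), ha'⟩, lt_of_le_of_ne hb (Ne.symm h3), hb'⟩
    refine (measure_mono hsub).trans ((measure_union_le _ _).trans ?_)
    rw [measure_union_null h0 h1, add_zero]
  have hr : ∀ a b : I, μ.real (Iic a ×ˢ Iic b) = C a b := fun a b => by
    rw [measureReal_def, h, ENNReal.toReal_ofReal (C.mem_Icc a b).1]
  have hstrip : ∀ b : I, μ.real (Ioc x u ×ˢ Iic b) = C u b - C x b := by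
    intro b
    have hd : Disjoint (Iic x ×ˢ Iic b : Set (I × I)) (Ioc x u ×ˢ Iic b) := by
      rw [disjoint_prod]
      left
      exact Iic_disjoint_Ioc le_rfl
    have := measureReal_union (μ := μ) hd (measurableSet_Ioc.prod measurableSet_Iic)
    rw [← union_prod, Iic_union_Ioc_eq_Iic hx, hr, hr] at this
    linarith
  have hd : Disjoint (Ioc x u ×ˢ Iic y : Set (I × I)) (Ioc x u ×ˢ Ioc y v) := by
    rw [disjoint_prod]
    right
    exact Iic_disjoint_Ioc le_rfl
  have := measureReal_union (μ := μ) hd (measurableSet_Ioc.prod measurableSet_Ioc)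
  rw [← prod_union, Iic_union_Ioc_eq_Iic hy, hstrip, hstrip] at this
  rw [hae, ← ENNReal.ofReal_toReal (measure_ne_top μ (Ioc x u ×ˢ Ioc y v)), ← measureReal_def]
  congr 1
  linarith

/-- Every copula induces a unique Borel measure on the unit square through
`μ([x,u] × [y,v]) = C(u,v) - C(u,y) - C(x,v) + C(x,y)`. -/
theorem existsUnique_measure (C : Copula) : ∃! μ : Measure (I × I),
    ∀ x u y v : I, x ≤ u → y ≤ v →
      μ (Icc x u ×ˢ Icc y v) = ENNReal.ofReal (C u v - C u y - C x v + C x y) := by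
  have hfin : IsFiniteMeasure C.lawMeasure := by
    unfold lawMeasure
    infer_instance
  refine ⟨C.lawMeasure, fun x u y v hx hy => C.measure_rect_of_Iic C.lawMeasure_Iic hx hy, ?_⟩
  intro ν hν
  refine (measure_ext_Iic fun x y => ?_).symm
  have := hν 0 x 0 y x.2.1 y.2.1
  have hI : ∀ a : I, Icc 0 a = Iic a := fun a => Icc_bot
  rw [hI, hI, C.right_zero, C.left_zero, C.left_zero, sub_zero, sub_zero, add_zero] at this
  rw [this, C.lawMeasure_Iic]

/-- The measure `μ_C` on the unit square induced by the copula `C`, i.e. the unique Borel measure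
with `μ_C([x,u] × [y,v]) = C(u,v) - C(u,y) - C(x,v) + C(x,y)`. -/
noncomputable def inducedMeasure (C : Copula) : Measure (I × I) :=
  C.existsUnique_measure.choose

theorem inducedMeasure_rect (C : Copula) {x u y v : I} (hx : x ≤ u) (hy : y ≤ v) :
    C.inducedMeasure (Icc x u ×ˢ Icc y v) =
      ENNReal.ofReal (C u v - C u y - C x v + C x y) :=
  C.existsUnique_measure.choose_spec.1 x u y v hx hy

end Copula

/-! ### Shuffles -/

/-- A measure-preserving bijection of `[0,1]` (with Lebesgue measure). -/
def IsMeasurePreservingBijection (T : I → I) : Prop :=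
  Function.Bijective T ∧ MeasurePreserving T volume volume

/-- `T` has only finitely many points of discontinuity, i.e. `T` is continuous on each open piece of
a suitable finite partition of `[0,1]`. -/
def IsPiecewiseContinuous (T : I → I) : Prop :=
  {x : I | ¬ ContinuousAt T x}.Finite

/-- The shuffling `S_T(u, v) = (T(u), v)`. -/
def shuffling (T : I → I) (p : I × I) : I × I := (T p.1, p.2)

namespace Copula

/-- `C` is a shuffle of `D`: `μ_C` is the push-forward of `μ_D` under `S_T` for some
piecewise-continuous measure-preserving bijection `T`. -/
def IsShuffleOf (C D : Copula) : Prop :=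
  ∃ T : I → I, IsMeasurePreservingBijection T ∧ IsPiecewiseContinuous T ∧
    C.inducedMeasure = D.inducedMeasure.map (shuffling T)

/-- `C` is a generalized shuffle of `D`: `μ_C` is the push-forward of `μ_D` under `S_T` for some
measure-preserving bijection `T`. -/
def IsGeneralizedShuffleOf (C D : Copula) : Prop :=
  ∃ T : I → I, IsMeasurePreservingBijection T ∧
    C.inducedMeasure = D.inducedMeasure.map (shuffling T)

end Copula

/-! ### Lebesgue measure on the unit interval -/

/-! Let `A` be the copula whose measure is the push-forward of `μ_M` under `S_T`, that is, the law
of `(T t, t)` with `t` uniform. Then `∂₂A(x, ·)` is almost everywhere the indicator of `T⁻¹[0,x]`,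
so `(A * D)(x,y)` is the integral of `∂₁D(·, y)` over that set. This integral is `μ_D(T⁻¹[0,x] ×
[0,y])`, the distribution function of the push-forward of `μ_D` under `S_T`
(`star_eq_of_inducedMeasure_eq`). Hence, for one and the same `T`, `C` is the shuffling of `D` by
`T` exactly when `C = A * D`. This gives the first two equivalences, with piecewise continuity of
`T` simply carried along.

For the norm, both partial derivatives lie in `[0,1]` and each has integral `1/2` over the square.
So `‖A‖² = 1 - ∫∫ ∂₁A(1 - ∂₁A) - ∫∫ ∂₂A(1 - ∂₂A)`, and `‖A‖ = 1` means that both derivatives are `0`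
or `1` almost everywhere. By `defect_eq_zero_iff`, applied to `A` and to its transpose, this says
that `μ_A` is the law of some `(t, S t)` and also of some `(T t, t)`. Then `S ∘ T = id` almost
everywhere, and `T` can be changed on a null set into a measure-preserving bijection
(`exists_isMeasurePreservingBijection_ae_eq`). -/

theorem not_countable_setOf_liouville : ¬ {x : ℝ | Liouville x}.Countable := by
  intro h
  -- A countable set has a residual complement, while the Liouville numbers are themselves residual;
  -- the Baire category theorem forbids both at once.
  have h1 : {x : ℝ | Liouville x}ᶜ ∈ residual ℝ :=
    residual_of_dense_Gδ h.isGδ_compl (h.dense_compl ℝ)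
  have h2 : ({x : ℝ | Liouville x}ᶜ ∩ {x : ℝ | Liouville x}) ∈ residual ℝ :=
    Filter.inter_mem h1 eventually_residual_liouville
  rw [compl_inter_self] at h2
  exact (dense_of_mem_residual h2).nonempty.ne_empty rfl

/-- There is a Borel null set in the unit interval which is uncountable. -/
theorem unitInterval.exists_null_not_countable :
    ∃ K : Set I, MeasurableSet K ∧ volume K = 0 ∧ ¬ K.Countable := by
  have hL : MeasurableSet {x : ℝ | Liouville x} := IsGδ.setOfPred_liouville.measurableSet
  -- The null set is the union of the traces on `[0,1]` of all integer translates of the Liouville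
  -- numbers. Since `x = fract x + ⌊x⌋`, countability of this union would make all Liouville numbers
  -- countable.
  let f : ℤ → I → ℝ := fun n y => (y : ℝ) + n
  have hf : ∀ n, Measurable (f n) := fun n => measurable_subtype_coe.add_const _
  refine ⟨⋃ n : ℤ, f n ⁻¹' {x : ℝ | Liouville x}, .iUnion fun n => hf n hL,
    measure_iUnion_null fun n => ?_, fun h => not_countable_setOf_liouville ?_⟩
  · have h1 : volume ((fun x : ℝ => x + n) ⁻¹' {x : ℝ | Liouville x}) = 0 := by
      rw [(measurePreserving_add_right volume (n : ℝ)).measure_preimage hL.nullMeasurableSet]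
      exact volume_setOfPred_liouville
    have h2 := measurePreserving_coe.measure_preimage
      (hL.preimage (measurable_id.add_const (n : ℝ))).nullMeasurableSet
    refine h2.trans (le_antisymm ?_ bot_le)
    exact (Measure.restrict_apply_le _ _).trans h1.le
  · refine (countable_iUnion fun n : ℤ => h.image (f n)).mono fun x hx => ?_
    have hmem : Int.fract x ∈ I := ⟨Int.fract_nonneg x, (Int.fract_lt_one x).le⟩
    have hx' : f ⌊x⌋ ⟨Int.fract x, hmem⟩ = x := Int.fract_add_floor x
    refine mem_iUnion.2 ⟨⌊x⌋, ⟨Int.fract x, hmem⟩, mem_iUnion.2 ⟨⌊x⌋, ?_⟩, hx'⟩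
    rw [mem_preimage, hx']
    exact hx

/-- A continuous function on the unit interval vanishes if it vanishes almost everywhere. -/
theorem unitInterval.eq_zero_of_ae_eq_zero {f : I → ℝ} (hf : Continuous f)
    (h : ∀ᵐ x, f x = 0) (x : I) : f x = 0 := by
  have h1 : ∀ᵐ s ∂(volume.restrict (Icc (0 : ℝ) 1)), f (projIcc 0 1 zero_le_one s) = 0 := by
    have := measurePreserving_coe.map_eq
    rw [← this, measurableEmbedding_coe.ae_map_iff]
    simpa using h
  have h2 := Measure.eqOn_Icc_of_ae_eq (μ := volume) (zero_ne_one (α := ℝ))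
    (g := fun _ => 0) h1 (hf.comp continuous_projIcc).continuousOn continuousOn_const
  simpa using h2 x.2

theorem MeasureTheory.not_countable_subtype_of_subset {α : Type*} {s t : Set α} (h : s ⊆ t)
    (hs : ¬ s.Countable) : ¬ Countable t :=
  fun ht => hs ((countable_coe_iff.1 ht).mono h)

/-- A measure-preserving map of the unit interval with an almost everywhere left inverse agrees
almost everywhere with a measure-preserving bijection. -/
theorem exists_isMeasurePreservingBijection_ae_eq {S T : I → I}
    (hS : MeasurePreserving S volume volume) (hT : MeasurePreserving T volume volume) (hST : ∀ᵐ x, S (T x) = x) :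
    ∃ T' : I → I, IsMeasurePreservingBijection T' ∧ T' =ᵐ[volume] T := by
  classical
  obtain ⟨K, hKm, hK0, hKc⟩ := unitInterval.exists_null_not_countable
  -- On `X` and `Y` the maps `T` and `S` are inverse to each other. Removing `K` and its preimages
  -- keeps this true and makes both complements contain `K`, hence uncountable.
  let X : Set I := {x | S (T x) = x ∧ x ∉ K ∧ T x ∉ K}
  let Y : Set I := {y | T (S y) = y ∧ y ∉ K ∧ S y ∉ K}
  have hXm : MeasurableSet X :=
    (measurableSet_eq_fun (hS.measurable.comp hT.measurable) measurable_id).inter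
      (hKm.compl.inter (hT.measurable hKm.compl))
  have hYm : MeasurableSet Y :=
    (measurableSet_eq_fun (hT.measurable.comp hS.measurable) measurable_id).inter
      (hKm.compl.inter (hS.measurable hKm.compl))
  have hK : ∀ᵐ x : I, x ∉ K := measure_eq_zero_iff_ae_notMem.1 hK0
  have hX : ∀ᵐ x : I, x ∈ X := by
    filter_upwards [hST, hK, hT.quasiMeasurePreserving.ae hK] with x h1 h2 h3 using ⟨h1, h2, h3⟩
  have hTX : ∀ x ∈ X, T x ∈ Y := fun x hx =>
    ⟨congrArg T hx.1, hx.2.2, fun h => hx.2.1 (hx.1 ▸ h)⟩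
  have hSY : ∀ y ∈ Y, S y ∈ X := fun y hy =>
    ⟨congrArg S hy.1, hy.2.2, fun h => hy.2.1 (hy.1 ▸ h)⟩
  let e : X ≃ᵐ Y :=
    { toFun x := ⟨T x, hTX x x.2⟩
      invFun y := ⟨S y, hSY y y.2⟩
      left_inv x := Subtype.ext x.2.1
      right_inv y := Subtype.ext y.2.1
      measurable_toFun := (hT.measurable.comp measurable_subtype_coe).subtype_mk
      measurable_invFun := (hS.measurable.comp measurable_subtype_coe).subtype_mk }
  have hXc : ¬ Countable (Xᶜ : Set I) :=
    not_countable_subtype_of_subset (fun x hx h => h.2.1 hx) hKc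
  have hYc : ¬ Countable (Yᶜ : Set I) :=
    not_countable_subtype_of_subset (fun x hx h => h.2.1 hx) hKc
  have : StandardBorelSpace (Xᶜ : Set I) := hXm.compl.standardBorel
  have : StandardBorelSpace (Yᶜ : Set I) := hYm.compl.standardBorel
  -- Uncountable standard Borel spaces are isomorphic. Any isomorphism will do, because `Xᶜ` is
  -- null.
  let e' : (Xᶜ : Set I) ≃ᵐ (Yᶜ : Set I) := PolishSpace.measurableEquivOfNotCountable hXc hYc
  let g : I ≃ᵐ I := (MeasurableEquiv.sumCompl hXm).symm.trans
    ((e.sumCongr e').trans (MeasurableEquiv.sumCompl hYm))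
  have hg : ∀ x ∈ X, g x = T x := fun x hx => by
    show (Equiv.Set.sumCompl Y) (Equiv.sumCongr e.toEquiv e'.toEquiv
      ((Equiv.Set.sumCompl X).symm x)) = T x
    rw [Equiv.Set.sumCompl_symm_apply_of_mem hx]
    rfl
  have hgT : g =ᵐ[volume] T := hX.mono hg
  refine ⟨g, ⟨g.bijective, g.measurable, ?_⟩, hgT⟩
  rw [Measure.map_congr hgT, hT.map_eq]

namespace Copula

/-! ### The induced measure -/

theorem inducedMeasure_Iic (C : Copula) (x y : I) :
    C.inducedMeasure (Iic x ×ˢ Iic y) = ENNReal.ofReal (C x y) := by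
  have h := C.inducedMeasure_rect (x := 0) (u := x) (y := 0) (v := y) x.2.1 y.2.1
  have hI : ∀ a : I, Icc 0 a = Iic a := fun a => Icc_bot
  simpa only [hI, C.right_zero, C.left_zero, sub_zero, add_zero] using h

theorem _root_.unitInterval.Iic_one : (Iic 1 : Set I) = univ := eq_univ_of_forall fun x => x.2.2

instance (C : Copula) : IsProbabilityMeasure C.inducedMeasure where
  measure_univ := by
    rw [← univ_prod_univ, ← Iic_one, inducedMeasure_Iic, C.right_one]
    simp

theorem inducedMeasure_eq_of_Iic (C : Copula) {μ : Measure (I × I)}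
    (h : ∀ x y : I, μ (Iic x ×ˢ Iic y) = ENNReal.ofReal (C x y)) : C.inducedMeasure = μ :=
  measure_ext_Iic fun x y => by rw [inducedMeasure_Iic, h]

theorem inducedMeasure_eq_lawMeasure (C : Copula) : C.inducedMeasure = C.lawMeasure :=
  C.inducedMeasure_eq_of_Iic C.lawMeasure_Iic

theorem inducedMeasure_real_Iic (C : Copula) (x y : I) :
    C.inducedMeasure.real (Iic x ×ˢ Iic y) = C x y := by
  rw [measureReal_def, inducedMeasure_Iic, ENNReal.toReal_ofReal (C.mem_Icc x y).1]

theorem map_fst_inducedMeasure (C : Copula) : C.inducedMeasure.map Prod.fst = volume := by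
  refine Measure.ext_of_Iic _ _ fun a => ?_
  rw [Measure.map_apply measurable_fst measurableSet_Iic, ← prod_univ, ← Iic_one,
    inducedMeasure_Iic, C.right_one, unitInterval.volume_Iic]

theorem map_snd_inducedMeasure (C : Copula) : C.inducedMeasure.map Prod.snd = volume := by
  refine Measure.ext_of_Iic _ _ fun a => ?_
  rw [Measure.map_apply measurable_snd measurableSet_Iic, ← univ_prod, ← Iic_one,
    inducedMeasure_Iic, C.left_one, unitInterval.volume_Iic]

/-- The copula of a measure on the unit square with uniform margins. -/
noncomputable def ofMeasure (μ : Measure (I × I)) (h1 : μ.map Prod.fst = volume)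
    (h2 : μ.map Prod.snd = volume) : Copula :=
  have hfst : ∀ x, μ (Prod.fst ⁻¹' Iic x) = ENNReal.ofReal x := fun x => by
    rw [← Measure.map_apply measurable_fst measurableSet_Iic, h1, unitInterval.volume_Iic]
  have hsnd : ∀ x, μ (Prod.snd ⁻¹' Iic x) = ENNReal.ofReal x := fun x => by
    rw [← Measure.map_apply measurable_snd measurableSet_Iic, h2, unitInterval.volume_Iic]
  have hprob : IsProbabilityMeasure μ := ⟨by
    have := hfst 1
    rwa [Iic_one, preimage_univ, Icc.coe_one, ENNReal.ofReal_one] at this⟩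
  { toFun x y := μ.real (Iic x ×ˢ Iic y)
    mem_Icc _ _ := ⟨measureReal_nonneg, measureReal_le_one⟩
    right_zero u := by
      rw [measureReal_def, measure_mono_null (t := Prod.snd ⁻¹' Iic 0) (fun p hp => hp.2)
        (by rw [hsnd]; simp), ENNReal.toReal_zero]
    left_zero v := by
      rw [measureReal_def, measure_mono_null (t := Prod.fst ⁻¹' Iic 0) (fun p hp => hp.1)
        (by rw [hfst]; simp), ENNReal.toReal_zero]
    right_one u := by
      rw [Iic_one, prod_univ, measureReal_def, hfst, ENNReal.toReal_ofReal u.2.1]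
    left_one v := by
      rw [Iic_one, univ_prod, measureReal_def, hsnd, ENNReal.toReal_ofReal v.2.1]
    two_increasing x u y v hx hy := by
      have hstrip : ∀ b : I, μ.real (Iic u ×ˢ Iic b) =
          μ.real (Iic x ×ˢ Iic b) + μ.real (Ioc x u ×ˢ Iic b) := fun b => by
        rw [← measureReal_union (disjoint_prod.2 (Or.inl (Iic_disjoint_Ioc le_rfl)))
          (measurableSet_Ioc.prod measurableSet_Iic), ← union_prod, Iic_union_Ioc_eq_Iic hx]
      have := measureReal_mono (μ := μ) (prod_mono_right (s := Ioc x u) (Iic_subset_Iic.2 hy))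
      linarith [hstrip v, hstrip y] }

theorem inducedMeasure_ofMeasure (μ : Measure (I × I)) (h1 : μ.map Prod.fst = volume)
    (h2 : μ.map Prod.snd = volume) : (ofMeasure μ h1 h2).inducedMeasure = μ := by
  have hprob : IsProbabilityMeasure μ :=
    ⟨by rw [← preimage_univ (f := Prod.fst), ← Measure.map_apply measurable_fst .univ, h1,
      measure_univ]⟩
  exact inducedMeasure_eq_of_Iic _ fun x y => (ofReal_measureReal (measure_ne_top _ _)).symm

theorem inducedMeasure_M : M.inducedMeasure = (volume : Measure I).map fun t => (t, t) := by
  refine inducedMeasure_eq_of_Iic _ fun x y => ?_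
  rw [Measure.map_apply (measurable_id'.prodMk measurable_id')
    (measurableSet_Iic.prod measurableSet_Iic)]
  have h : (fun t : I => (t, t)) ⁻¹' Iic x ×ˢ Iic y = Iic (min x y) := by
    ext t
    simp
  rw [h, unitInterval.volume_Iic]
  congr 1

/-- The intervals `[0,x]` determine a finite measure on `[0,1]`, and on them the identity is the
fundamental theorem of calculus, `setLIntegral_partial1`. -/
theorem inducedMeasure_prod_Iic (C : Copula) {s : Set I} (hs : MeasurableSet s) (y : I) :
    C.inducedMeasure (s ×ˢ Iic y) = ∫⁻ t in s, ENNReal.ofReal (C.partial1 t y) := by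
  have hν : (C.inducedMeasure.restrict (univ ×ˢ Iic y)).map Prod.fst =
      volume.withDensity fun t => ENNReal.ofReal (C.partial1 t y) := by
    refine Measure.ext_of_Iic _ _ fun x => ?_
    rw [Measure.map_apply measurable_fst measurableSet_Iic,
      Measure.restrict_apply (measurable_fst measurableSet_Iic),
      withDensity_apply _ measurableSet_Iic, setLIntegral_partial1, ← inducedMeasure_Iic]
    congr 1
    ext p
    simp [Prod.le_def]
  rw [← withDensity_apply _ hs, ← hν, Measure.map_apply measurable_fst hs,
    Measure.restrict_apply (measurable_fst hs)]
  congr 1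
  ext p
  simp

theorem integrable_partial1 (C : Copula) (y : I) : Integrable fun x => C.partial1 x y := by
  refine Integrable.of_bound (C.measurable_partial1 y).aestronglyMeasurable 1 (ae_of_all _ fun s => ?_)
  rw [Real.norm_of_nonneg (C.partial1_nonneg s y)]
  exact C.partial1_le_one s y

theorem setIntegral_partial1_eq_inducedMeasure (C : Copula) {s : Set I} (hs : MeasurableSet s)
    (y : I) : ∫ t in s, C.partial1 t y = C.inducedMeasure.real (s ×ˢ Iic y) := by
  rw [measureReal_def, inducedMeasure_prod_Iic _ hs,
    ← ofReal_integral_eq_lintegral_ofReal (C.integrable_partial1 y).integrableOn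
      (ae_of_all _ fun s => C.partial1_nonneg s y),
    ENNReal.toReal_ofReal (integral_nonneg fun s => C.partial1_nonneg s y)]

/-! ### Transposition -/

/-- The copula `(x, y) ↦ C(y, x)`. -/
def transpose (C : Copula) : Copula where
  toFun x y := C y x
  mem_Icc u v := C.mem_Icc v u
  right_zero := C.left_zero
  left_zero := C.right_zero
  right_one := C.left_one
  left_one := C.right_one
  two_increasing x u y v hx hy := by
    have := C.two_increasing y v x u hy hx
    linarith

/-- Through this identity every result on `∂₁` becomes one on `∂₂`. -/
theorem partial1_transpose (C : Copula) (x y : I) : C.transpose.partial1 x y = C.partial2 y x :=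
  rfl

theorem inducedMeasure_transpose (C : Copula) :
    C.transpose.inducedMeasure = C.inducedMeasure.map Prod.swap := by
  refine inducedMeasure_eq_of_Iic _ fun x y => ?_
  rw [Measure.map_apply measurable_swap (measurableSet_Iic.prod measurableSet_Iic),
    preimage_swap_prod, inducedMeasure_Iic]
  rfl

/-- If the measure of `C` is carried by the graph of `S`, then `∂₁C` is an indicator. -/
theorem partial1_ae_eq_indicator (C : Copula) {S : I → I} (hS : Measurable S)
    (h : C.inducedMeasure = volume.map fun t => (t, S t)) (y : I) :
    (fun t => C.partial1 t y) =ᵐ[volume] (S ⁻¹' Iic y).indicator 1 := by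
  -- Over every Borel set `s` both functions have the integral `μ_C(s × [0,y])`, which is the volume
  -- of `s ∩ S⁻¹[0,y]`.
  refine Integrable.ae_eq_of_forall_setIntegral_eq _ _ (C.integrable_partial1 y)
    ((integrable_const (1 : ℝ)).indicator (hS measurableSet_Iic)) fun s hs _ => ?_
  rw [setIntegral_partial1_eq_inducedMeasure _ hs, h, measureReal_def,
    Measure.map_apply (measurable_id'.prodMk hS) (hs.prod measurableSet_Iic),
    setIntegral_indicator (hS measurableSet_Iic)]
  simp [measureReal_def, mk_preimage_prod]

/-! ### Shufflings as products -/

theorem _root_.measurable_shuffling {T : I → I} (hT : Measurable T) :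
    Measurable (shuffling T) :=
  (hT.comp measurable_fst).prodMk measurable_snd

/-- If the measure of `A` is the law of `(T(t), t)`, then `A * D` is the copula of the push-forward
of the measure of `D` under `S_T`. -/
theorem star_eq_of_inducedMeasure_eq (A D : Copula) {T : I → I} (hT : Measurable T)
    (h : A.inducedMeasure = volume.map fun t => (T t, t)) (x y : I) :
    A.star D x y = (D.inducedMeasure.map (shuffling T)).real (Iic x ×ˢ Iic y) := by
  have hA : A.transpose.inducedMeasure = volume.map fun t => (t, T t) := by
    rw [inducedMeasure_transpose, h,
      Measure.map_map measurable_swap (hT.prodMk measurable_id')]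
    rfl
  have hsh := measurable_shuffling hT
  have hE : MeasurableSet (T ⁻¹' Iic x) := hT measurableSet_Iic
  have h1 : A.star D x y = ∫ t, (T ⁻¹' Iic x).indicator (fun t => D.partial1 t y) t := by
    refine integral_congr_ae ?_
    filter_upwards [A.transpose.partial1_ae_eq_indicator hT hA x] with t ht
    rw [partial1_transpose] at ht
    rw [ht]
    by_cases hx : t ∈ T ⁻¹' Iic x <;> simp [hx]
  rw [h1, integral_indicator hE, setIntegral_partial1_eq_inducedMeasure _ hE, measureReal_def,
    measureReal_def, Measure.map_apply hsh (measurableSet_Iic.prod measurableSet_Iic)]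
  rfl

theorem map_shuffling_inducedMeasure_M {T : I → I} (hT : Measurable T) :
    M.inducedMeasure.map (shuffling T) = volume.map fun t => (T t, t) := by
  rw [inducedMeasure_M, Measure.map_map (measurable_shuffling hT)
    (measurable_id'.prodMk measurable_id')]
  rfl

/-- For measure-preserving `T` there is a copula whose measure is the push-forward of the measure
of `D` under `S_T`. -/
theorem exists_inducedMeasure_eq_map_shuffling (D : Copula) {T : I → I}
    (hT : MeasurePreserving T volume volume) :
    ∃ C : Copula, C.inducedMeasure = D.inducedMeasure.map (shuffling T) := by
  have hsh := measurable_shuffling hT.measurable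
  refine ⟨ofMeasure _ ?_ ?_, inducedMeasure_ofMeasure _ _ _⟩
  · rw [Measure.map_map measurable_fst hsh]
    calc _ = (D.inducedMeasure.map Prod.fst).map T :=
          (Measure.map_map hT.measurable measurable_fst).symm
      _ = volume := by rw [map_fst_inducedMeasure, hT.map_eq]
  · rw [Measure.map_map measurable_snd hsh]
    exact D.map_snd_inducedMeasure

/-- `A * D` is the distribution function of the push-forward, and distribution functions determine
measures. Both sides involve the same `T`, so any further regularity of `T` passes between them. -/
theorem inducedMeasure_eq_map_shuffling_iff (A C D : Copula) {T : I → I}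
    (hT : MeasurePreserving T volume volume)
    (hA : A.inducedMeasure = M.inducedMeasure.map (shuffling T)) :
    C.inducedMeasure = D.inducedMeasure.map (shuffling T) ↔ ∀ x y, C x y = A.star D x y := by
  rw [map_shuffling_inducedMeasure_M hT.measurable] at hA
  have hsh := measurable_shuffling hT.measurable
  have := Measure.isProbabilityMeasure_map (μ := D.inducedMeasure) hsh.aemeasurable
  simp_rw [A.star_eq_of_inducedMeasure_eq D hT.measurable hA]
  refine ⟨fun h x y => by rw [← h, inducedMeasure_real_Iic], fun h => ?_⟩
  refine inducedMeasure_eq_of_Iic _ fun x y => ?_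
  rw [h, ofReal_measureReal]

theorem isShuffleOf_iff (C D : Copula) :
    C.IsShuffleOf D ↔ ∃ A : Copula, A.IsShuffleOf M ∧ ∀ x y, C x y = A.star D x y := by
  constructor
  · rintro ⟨T, hT, hc, h⟩
    obtain ⟨A, hA⟩ := M.exists_inducedMeasure_eq_map_shuffling hT.2
    exact ⟨A, ⟨T, hT, hc, hA⟩, (inducedMeasure_eq_map_shuffling_iff A C D hT.2 hA).1 h⟩
  · rintro ⟨A, ⟨T, hT, hc, hA⟩, h⟩
    exact ⟨T, hT, hc, (inducedMeasure_eq_map_shuffling_iff A C D hT.2 hA).2 h⟩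

theorem isGeneralizedShuffleOf_iff (C D : Copula) :
    C.IsGeneralizedShuffleOf D ↔
      ∃ A : Copula, A.IsGeneralizedShuffleOf M ∧ ∀ x y, C x y = A.star D x y := by
  constructor
  · rintro ⟨T, hT, h⟩
    obtain ⟨A, hA⟩ := M.exists_inducedMeasure_eq_map_shuffling hT.2
    exact ⟨A, ⟨T, hT, hA⟩, (inducedMeasure_eq_map_shuffling_iff A C D hT.2 hA).1 h⟩
  · rintro ⟨A, ⟨T, hT, hA⟩, h⟩
    exact ⟨T, hT, (inducedMeasure_eq_map_shuffling_iff A C D hT.2 hA).2 h⟩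

end Copula

namespace Copula

/-! ### The Sobolev norm -/

/-- Being `1`-Lipschitz in each variable separately gives joint continuity, from which joint
measurability of `∂₁C` follows. -/
theorem continuous_ext (C : Copula) :
    Continuous (Function.uncurry fun (y : I) (s : ℝ) => C (projIcc 0 1 zero_le_one s) y) := by
  refine (LipschitzWith.uncurry (Kα := 1) (Kβ := 1) (fun s => ?_) C.lipschitz_ext).continuous
  have := (C.transpose.lipschitz_ext (projIcc 0 1 zero_le_one s)).comp
    (LipschitzWith.subtype_val I)
  simpa [Function.comp_def, transpose] using this

theorem measurable_uncurry_partial1 (C : Copula) :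
    Measurable fun p : I × I => C.partial1 p.1 p.2 :=
  (measurable_deriv_with_param C.continuous_ext).comp
    (measurable_snd.prodMk (measurable_subtype_coe.comp measurable_fst))

/-- The integral of `∂₁C (1 - ∂₁C)` along a horizontal line. -/
noncomputable def defect (C : Copula) (y : I) : ℝ :=
  ∫ x : I, (C.partial1 x y - C.partial1 x y ^ 2)

theorem partial1_sub_sq_nonneg (C : Copula) (x y : I) :
    0 ≤ C.partial1 x y - C.partial1 x y ^ 2 := by
  nlinarith [C.partial1_nonneg x y, C.partial1_le_one x y]

theorem abs_partial1_sub_sq_le (C : Copula) (x y : I) :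
    ‖C.partial1 x y - C.partial1 x y ^ 2‖ ≤ 1 := by
  rw [Real.norm_of_nonneg (C.partial1_sub_sq_nonneg x y)]
  nlinarith [C.partial1_le_one x y, sq_nonneg (C.partial1 x y)]

theorem integrable_uncurry_partial1_sub_sq (C : Copula) :
    Integrable fun p : I × I => C.partial1 p.1 p.2 - C.partial1 p.1 p.2 ^ 2 :=
  Integrable.of_bound (C.measurable_uncurry_partial1.sub
    (C.measurable_uncurry_partial1.pow_const 2)).aestronglyMeasurable 1
    (ae_of_all _ fun p => C.abs_partial1_sub_sq_le p.1 p.2)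

theorem integrable_partial1_sub_sq (C : Copula) (y : I) :
    Integrable fun x => C.partial1 x y - C.partial1 x y ^ 2 :=
  Integrable.of_bound ((C.measurable_partial1 y).sub
    ((C.measurable_partial1 y).pow_const 2)).aestronglyMeasurable 1
    (ae_of_all _ fun x => C.abs_partial1_sub_sq_le x y)

theorem integrable_uncurry_partial1 (C : Copula) :
    Integrable fun p : I × I => C.partial1 p.1 p.2 := by
  refine Integrable.of_bound C.measurable_uncurry_partial1.aestronglyMeasurable 1
    (ae_of_all _ fun p => ?_)
  rw [Real.norm_of_nonneg (C.partial1_nonneg _ _)]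
  exact C.partial1_le_one _ _

theorem integral_partial1 (C : Copula) (y : I) : ∫ x, C.partial1 x y = y := by
  have := C.setIntegral_partial1 1 y
  rwa [Iic_one, setIntegral_univ, C.left_one] at this

theorem _root_.unitInterval.integral_coe : ∫ y : I, (y : ℝ) = 1 / 2 := by
  have := measurePreserving_coe.integral_comp measurableEmbedding_coe (fun x : ℝ => x)
  rw [this, integral_Icc_eq_integral_Ioc, ← intervalIntegral.integral_of_le zero_le_one,
    integral_id]
  norm_num

/-- Write `a² = a - (a - a²)` with `a = ∂₁C`. Integrating `a` in `x` gives `y`, and then integrating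
in `y` gives `1/2`. -/
theorem integral_uncurry_partial1_sq (C : Copula) :
    ∫ p : I × I, C.partial1 p.1 p.2 ^ 2 = 1 / 2 - ∫ y, C.defect y := by
  have h1 : ∫ p : I × I, C.partial1 p.1 p.2 = 1 / 2 := by
    rw [Measure.volume_eq_prod, integral_prod_symm _ C.integrable_uncurry_partial1]
    simp_rw [integral_partial1]
    exact integral_coe
  have h2 : ∫ p : I × I, (C.partial1 p.1 p.2 - C.partial1 p.1 p.2 ^ 2) = ∫ y, C.defect y := by
    rw [Measure.volume_eq_prod, integral_prod_symm _ C.integrable_uncurry_partial1_sub_sq]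
    rfl
  rw [← h1, ← h2, ← integral_sub C.integrable_uncurry_partial1
    C.integrable_uncurry_partial1_sub_sq]
  simp

theorem integrable_uncurry_partial1_sq (C : Copula) :
    Integrable fun p : I × I => C.partial1 p.1 p.2 ^ 2 := by
  refine (C.integrable_uncurry_partial1.sub C.integrable_uncurry_partial1_sub_sq).congr
    (ae_of_all _ fun p => ?_)
  simp

theorem sobolevNorm_eq (C : Copula) :
    C.sobolevNorm = Real.sqrt (1 - ((∫ y, C.defect y) + ∫ y, C.transpose.defect y)) := by
  have hi : Integrable fun p : I × I => C.partial2 p.1 p.2 ^ 2 :=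
    C.transpose.integrable_uncurry_partial1_sq.swap
  have h2 : ∫ p : I × I, C.partial2 p.1 p.2 ^ 2 =
      ∫ p : I × I, C.transpose.partial1 p.1 p.2 ^ 2 :=
    integral_prod_swap (μ := (volume : Measure I)) (ν := (volume : Measure I))
      fun p : I × I => C.transpose.partial1 p.1 p.2 ^ 2
  have h := integral_prod_symm (μ := (volume : Measure I)) (ν := (volume : Measure I))
    (fun p : I × I => C.partial1 p.1 p.2 ^ 2 + C.partial2 p.1 p.2 ^ 2)
    (C.integrable_uncurry_partial1_sq.add hi)
  rw [sobolevNorm, ← h, ← Measure.volume_eq_prod,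
    integral_add C.integrable_uncurry_partial1_sq hi, h2, integral_uncurry_partial1_sq,
    integral_uncurry_partial1_sq]
  congr 1
  ring

theorem defect_nonneg (C : Copula) (y : I) : 0 ≤ C.defect y :=
  integral_nonneg fun x => C.partial1_sub_sq_nonneg x y

/-- For `0 ≤ a ≤ b ≤ 1` one has `|(b - b²) - (a - a²)| = (b - a)|1 - a - b| ≤ b - a`; this is
integrated with `a = ∂₁C(x,y)` and `b = ∂₁C(x,v)`. The resulting continuity of the defect turns
vanishing for almost every `y` into vanishing for every `y`, in particular at rational levels. -/
theorem abs_defect_sub_le (C : Copula) {y v : I} (h : y ≤ v) :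
    |C.defect v - C.defect y| ≤ v - y := by
  rw [← C.integral_partial1 v, ← C.integral_partial1 y,
    ← integral_sub (C.integrable_partial1 v) (C.integrable_partial1 y), defect, defect,
    ← integral_sub (C.integrable_partial1_sub_sq v) (C.integrable_partial1_sub_sq y)]
  rw [← Real.norm_eq_abs]
  refine norm_integral_le_of_norm_le ((C.integrable_partial1 v).sub (C.integrable_partial1 y)) ?_
  filter_upwards [C.ae_partial1_mono h] with x hx
  have h0 := C.partial1_nonneg x y
  have h1 := C.partial1_le_one x v
  rw [Real.norm_eq_abs, abs_le]
  constructor <;> nlinarith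

theorem continuous_defect (C : Copula) : Continuous C.defect := by
  refine (LipschitzWith.of_dist_le_mul (K := 1) fun y v => ?_).continuous
  rw [NNReal.coe_one, one_mul, Subtype.dist_eq, Real.dist_eq, Real.dist_eq]
  rcases le_total y v with h | h
  · rw [abs_sub_comm, abs_sub_comm (y : ℝ)]
    exact (C.abs_defect_sub_le h).trans (le_abs_self _)
  · exact (C.abs_defect_sub_le h).trans (le_abs_self _)

theorem integral_defect_eq_zero_iff (C : Copula) :
    ∫ y, C.defect y = 0 ↔ ∀ y, C.defect y = 0 := by
  refine ⟨fun h => ?_, fun h => by simp [h]⟩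
  rw [integral_eq_zero_iff_of_nonneg C.defect_nonneg
    (C.integrable_uncurry_partial1_sub_sq.integral_prod_right)] at h
  exact unitInterval.eq_zero_of_ae_eq_zero C.continuous_defect h

theorem sobolevNorm_eq_one_iff (C : Copula) :
    C.sobolevNorm = 1 ↔ (∀ y, C.defect y = 0) ∧ ∀ y, C.transpose.defect y = 0 := by
  have h1 := integral_nonneg (μ := volume) (f := C.defect) C.defect_nonneg
  have h2 := integral_nonneg (μ := volume) (f := C.transpose.defect) C.transpose.defect_nonneg
  rw [← integral_defect_eq_zero_iff, ← integral_defect_eq_zero_iff, sobolevNorm_eq,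
    Real.sqrt_eq_one]
  constructor
  · intro h
    constructor <;> linarith
  · rintro ⟨h3, h4⟩
    linarith

/-- The measure of `C` is carried by the graph of a function if and only if `∂₁C` takes the values
`0` and `1` only, up to null sets. -/
theorem defect_eq_zero_iff (C : Copula) : (∀ y, C.defect y = 0) ↔
    ∃ S : I → I, Measurable S ∧ C.inducedMeasure = volume.map fun t => (t, S t) := by
  constructor
  · intro h
    -- If `∂₁C` is `0` or `1`, the conditional law given the first coordinate is a point mass, and
    -- all its quantiles of positive level coincide. The median serves as `S`; any fixed level in
    -- `(0,1]` would do.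
    have hq : Measurable fun s => C.quantile (s, ⟨1 / 2, by norm_num, by norm_num⟩) :=
      C.measurable_quantile.comp (measurable_id'.prodMk measurable_const)
    refine ⟨_, hq, ?_⟩
    have hae : ∀ᵐ s : I, ∀ t : I, 0 < (t : ℝ) →
        C.quantile (s, t) = C.quantile (s, ⟨1 / 2, by norm_num, by norm_num⟩) := by
      -- The quantile only sees rational heights, so a single null set of `s` has to be discarded.
      have h01 : ∀ᵐ s : I, ∀ q : ℚ, C.partial1 s (projIcc 0 1 zero_le_one (q : ℝ)) -
          C.partial1 s (projIcc 0 1 zero_le_one (q : ℝ)) ^ 2 = 0 := by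
        refine ae_all_iff.2 fun q => ?_
        exact (integral_eq_zero_iff_of_nonneg (fun x => C.partial1_sub_sq_nonneg x _)
          (C.integrable_partial1_sub_sq _)).1 (h (projIcc 0 1 zero_le_one (q : ℝ)))
      filter_upwards [h01] with s hs t ht
      refine iInf_congr fun q => ?_
      have h3 : C.partial1 s (projIcc 0 1 zero_le_one (q : ℝ)) *
          (1 - C.partial1 s (projIcc 0 1 zero_le_one (q : ℝ))) = 0 := by
        linarith [hs q]
      have ht1 : (t : ℝ) ≤ 1 := t.2.2
      rcases mul_eq_zero.1 h3 with h4 | h4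
      · simp only [h4]
        rw [if_neg (not_le.2 ht), if_neg (by norm_num)]
      · rw [sub_eq_zero] at h4
        simp only [← h4]
        rw [if_pos ht1, if_pos (by norm_num)]
    have hpos : ∀ᵐ t : I, 0 < (t : ℝ) := by
      have : ∀ᵐ t : I, t ≠ 0 := Measure.ae_ne volume 0
      filter_upwards [this] with t ht using unitInterval.pos_iff_ne_zero.2 ht
    have hall : ∀ᵐ p : I × I, (p.1, C.quantile p) =
        (p.1, C.quantile (p.1, ⟨1 / 2, by norm_num, by norm_num⟩)) := by
      filter_upwards [Measure.quasiMeasurePreserving_fst.ae hae,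
        Measure.quasiMeasurePreserving_snd.ae hpos] with p h1 h2
      rw [← h1 p.2 h2]
    rw [inducedMeasure_eq_lawMeasure, lawMeasure, Measure.map_congr hall]
    have hfst : (volume : Measure (I × I)).map Prod.fst = volume :=
      measurePreserving_fst.map_eq
    conv_rhs => rw [← hfst]
    rw [Measure.map_map (measurable_id'.prodMk hq) measurable_fst]
    rfl
  · rintro ⟨S, hS, h⟩ y
    refine integral_eq_zero_of_ae ?_
    filter_upwards [C.partial1_ae_eq_indicator hS h y] with t ht
    rw [ht]
    by_cases hy : t ∈ S ⁻¹' Iic y <;> simp [hy]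

/-! ### Copulas of unit norm and generalized shuffles of Min -/

theorem measurePreserving_of_inducedMeasure_eq (C : Copula) {S : I → I} (hS : Measurable S)
    (h : C.inducedMeasure = volume.map fun t => (t, S t)) : MeasurePreserving S volume volume := by
  refine ⟨hS, ?_⟩
  have h2 := C.map_snd_inducedMeasure
  rw [h, Measure.map_map measurable_snd (measurable_id'.prodMk hS)] at h2
  exact h2

theorem inducedMeasure_transpose_eq_map_iff (C : Copula) {T : I → I} (hT : Measurable T) :
    C.transpose.inducedMeasure = volume.map (fun t => (t, T t)) ↔
      C.inducedMeasure = volume.map fun t => (T t, t) := by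
  constructor
  · intro h
    have h1 := C.transpose.inducedMeasure_transpose
    rw [h, Measure.map_map measurable_swap (measurable_id'.prodMk hT)] at h1
    exact h1
  · intro h
    rw [inducedMeasure_transpose, h, Measure.map_map measurable_swap (hT.prodMk measurable_id')]
    rfl

theorem isGeneralizedShuffleOf_M_iff (A : Copula) :
    A.IsGeneralizedShuffleOf M ↔ A.sobolevNorm = 1 := by
  rw [sobolevNorm_eq_one_iff, defect_eq_zero_iff, defect_eq_zero_iff]
  constructor
  · rintro ⟨T, ⟨hbij, hT⟩, h⟩
    rw [map_shuffling_inducedMeasure_M hT.measurable] at h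
    -- An injective Borel map between standard Borel spaces sends Borel sets to Borel sets, so `T⁻¹`
    -- is Borel and the law of `(T t, t)` is also that of `(t, T⁻¹ t)`.
    have hTe := hT.measurable.measurableEmbedding hbij.injective
    let e : I ≃ I := Equiv.ofBijective T hbij
    have he : Measurable e.symm := fun s hs => by
      rw [← e.image_eq_preimage_symm]
      exact hTe.measurableSet_image' hs
    refine ⟨⟨e.symm, he, ?_⟩,
      T, hT.measurable, (inducedMeasure_transpose_eq_map_iff A hT.measurable).2 h⟩
    rw [h]
    conv_rhs => rw [← hT.map_eq,
      Measure.map_map (measurable_id'.prodMk he) hT.measurable]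
    congr 1
    ext1 t
    exact congrArg (Prod.mk (T t)) (e.symm_apply_apply t).symm
  · rintro ⟨⟨S, hS, h1⟩, T, hT, h2⟩
    have hS' := A.measurePreserving_of_inducedMeasure_eq hS h1
    have hT' := A.transpose.measurePreserving_of_inducedMeasure_eq hT h2
    rw [inducedMeasure_transpose_eq_map_iff A hT] at h2
    -- `μ_A` is carried by the graph of `S` and is also the law of `(T t, t)`; comparing the two
    -- gives `S (T t) = t` for almost every `t`.
    have hae : ∀ᵐ p ∂A.inducedMeasure, S p.1 = p.2 := by
      rw [h1, ae_map_iff (measurable_id'.prodMk hS).aemeasurable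
        (measurableSet_eq_fun (hS.fun_comp measurable_fst) measurable_snd)]
      exact ae_of_all _ fun t => rfl
    rw [h2] at hae
    obtain ⟨T', hT'b, hT'e⟩ := exists_isMeasurePreservingBijection_ae_eq hS' hT'
      (ae_of_ae_map (hT.prodMk measurable_id').aemeasurable hae)
    refine ⟨T', hT'b, ?_⟩
    rw [map_shuffling_inducedMeasure_M hT'b.2.measurable, h2]
    refine Measure.map_congr ?_
    filter_upwards [hT'e] with t ht
    rw [ht]

end Copula

theorem mainTheorem3 (C D : Copula) :
    (C.IsShuffleOf D ↔
      ∃ A : Copula, A.IsShuffleOf Copula.M ∧ ∀ x y : unitInterval, C x y = A.star D x y) ∧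
    (C.IsGeneralizedShuffleOf D ↔
      ∃ A : Copula, A.IsGeneralizedShuffleOf Copula.M ∧
        ∀ x y : unitInterval, C x y = A.star D x y) ∧
    (C.IsGeneralizedShuffleOf D ↔
      ∃ A : Copula, A.sobolevNorm = 1 ∧ ∀ x y : unitInterval, C x y = A.star D x y) := by
  refine ⟨C.isShuffleOf_iff D, C.isGeneralizedShuffleOf_iff D, ?_⟩
  simp_rw [← Copula.isGeneralizedShuffleOf_M_iff]
  exact C.isGeneralizedShuffleOf_iff D
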